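/- Let $K$ be a field and let $y$ and $X=\{x_1,\dots,x_n\}$ be variables over $K$. Let $V$ be a discrete valuation domain with $K[y]\subseteq V\subseteq K[[y]]$ whose completion is $\widehat V=K[[y]]$ (compatibly with the inclusion $V\subseteq K[[y]]$), and assume that the field $K((y))=K[[y]][1/y]$ has uncountable transcendence degree over the quotient field $\mathcal Q(V)$ of $V$. Set $R_0=V[[X]]$ and $R=K[[y,X]]$, and write $XR=(x_1,\dots,x_n)R$. Let $P$ be a prime ideal of $R$ such that $P\subseteq XR$ and $\dim(R/P)>2$. Then there is a prime ideal $Q$ of $R$ such that (1) $P\subsetneq Q\subsetneq XR$, (2) $\dim(R/Q)=2$, and (3) $P\cap R_0=Q\cap R_0$. In particular, $P\cap K[[X]]=Q\cap K[[X]]$. -/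

import Mathlib

open scoped PowerSeries LaurentSeries

noncomputable section

/-- The quotient field `Q(V)` of a subring `V` of `K[[y]]`, formed inside `K((y))`:
the smallest subfield of `K((y))` that contains `V`. -/
def quotientSubfield {K : Type*} [Field K] (V : Subring K⟦X⟧) : Subfield K⸨X⸩ :=
  Subfield.closure ((algebraMap K⟦X⟧ K⸨X⸩) '' (V : Set K⟦X⟧))

/-- The ring `R = K[[y, x₁, …, xₙ]]`, as the ring `K[[y]][[x₁, …, xₙ]]` of formal power series
in `x₁, …, xₙ` with coefficients in `K[[y]]`. -/
abbrev PowerSeriesYX (K : Type*) [Field K] (n : ℕ) : Type _ :=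
  MvPowerSeries (Fin n) K⟦X⟧

/-- The ideal `XR = (x₁, …, xₙ)R` of `R = K[[y, x₁, …, xₙ]]`. -/
def idealXR (K : Type*) [Field K] (n : ℕ) : Ideal (PowerSeriesYX K n) :=
  Ideal.span (Set.range fun i : Fin n => (MvPowerSeries.X i : PowerSeriesYX K n))

/-- The inclusion of `R₀ = V[[x₁, …, xₙ]]` in `R = K[[y, x₁, …, xₙ]]`, coefficientwise. -/
def inclR₀ {K : Type*} [Field K] (V : Subring K⟦X⟧) (n : ℕ) :
    MvPowerSeries (Fin n) V →+* PowerSeriesYX K n :=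
  MvPowerSeries.map V.subtype

/-- The inclusion of `K[[x₁, …, xₙ]]` in `R = K[[y, x₁, …, xₙ]]`, coefficientwise. -/
def inclKX (K : Type*) [Field K] (n : ℕ) :
    MvPowerSeries (Fin n) K →+* PowerSeriesYX K n :=
  MvPowerSeries.map (PowerSeries.C (R := K))

end

/-! Since R is noetherian, it suffices to enlarge P inside XR without changing its contraction to R₀
while dim R/P > 2: a maximal such enlargement Q has dim R/Q ≤ 2, and Q ⊊ XR ⊊ 𝔪 gives equality.
K[[X]] embeds in R₀ because K ⊆ V.

To enlarge P, pass to S = L'[[X]] with L' an algebraic closure of K((y)); there X generates the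
maximal ideal. By `exists_minimalPrime_over_of_two_lt_ringKrullDim` some minimal prime P₁ of PS lies
over P and is not adjacent to the maximal ideal. Choose u ∈ XR outside P, then v ∈ XR outside every
minimal prime of P₁ + (u), and let Q' be minimal over P₁ + (u - ωv) with ω ∈ K((y)). Krull's
principal ideal theorem prevents Q' from containing both u and v, so Q' ∩ R ≠ XR; clearing the
denominator of ω shows Q' ∩ R ≠ P.

The contraction to R₀ is unchanged by a conjugation argument (`mem_and_mem_of_infinite_conjugates`).
The uncountable transcendence degree yields automorphisms of L' that fix V and all coefficients of
u, v and generators of P, but move ω to infinitely many values (`exists_infinite_family_conjugate`).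
If Q' contained some f ∈ R₀ outside P, the conjugates of Q' would be minimal over p + (f) with p a
minimal prime of PS, so only finitely many. Two values ω₁ ≠ ω₂ would then share a conjugate, which
contains (ω₁ - ω₂)v, hence v and u; so Q' would contain both. -/

/-! ### Depth and heights of primes in a noetherian local ring -/

section DepthModulo

variable {S : Type*} [CommRing S]

/-- `z` is a nonzerodivisor modulo the ideal `J`. -/
def IsRegularModulo (z : S) (J : Ideal S) : Prop :=
  ∀ a, z * a ∈ J → a ∈ J

/-- `q` is an associated prime of `S ⧸ J`. -/
def IsAssociatedTo (q J : Ideal S) : Prop :=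
  q.IsPrime ∧ ∃ a, ∀ x, x ∈ q ↔ x * a ∈ J

/-- `S ⧸ J` is nontrivial and admits a regular sequence of length `r` in the maximal ideal. -/
def DepthModuloGE [IsLocalRing S] : ℕ → Ideal S → Prop
  | 0, J => J ≠ ⊤
  | r + 1, J => ∃ z ∈ IsLocalRing.maximalIdeal S,
      IsRegularModulo z J ∧ DepthModuloGE r (J ⊔ Ideal.span {z})

theorem mem_sup_span_singleton_iff {J : Ideal S} {z a : S} :
    a ∈ J ⊔ Ideal.span {z} ↔ ∃ j ∈ J, ∃ b, a = j + z * b := by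
  rw [Submodule.mem_sup]
  constructor
  · rintro ⟨j, hj, y, hy, rfl⟩
    obtain ⟨b, rfl⟩ := Ideal.mem_span_singleton'.1 hy
    exact ⟨j, hj, b, by ring⟩
  · rintro ⟨j, hj, b, rfl⟩
    exact ⟨j, hj, z * b, Ideal.mul_mem_right _ _ (Ideal.mem_span_singleton_self z), rfl⟩

theorem isAssociatedTo_of_mem_associatedPrimes [IsNoetherianRing S] {J q : Ideal S}
    (hq : q ∈ associatedPrimes S (S ⧸ J)) : IsAssociatedTo q J := by
  obtain ⟨hp, x, hx⟩ := (isAssociatedPrime_iff).1 (AssociatedPrimes.mem_iff.1 hq)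
  obtain ⟨a, rfl⟩ := Ideal.Quotient.mk_surjective x
  refine ⟨hp, a, fun y => ?_⟩
  rw [hx, Submodule.mem_colon_singleton, ← Ideal.Quotient.eq_zero_iff_mem, map_mul]
  rfl

theorem exists_isAssociatedTo_of_notMem [IsNoetherianRing S] {J : Ideal S} {b : S} (hb : b ∉ J) :
    ∃ q ∈ associatedPrimes S (S ⧸ J), ∀ x, x * b ∈ J → x ∈ q := by
  obtain ⟨q, hq, hle⟩ := exists_le_isAssociatedPrime_of_isNoetherianRing S
    (Ideal.Quotient.mk J b) (by rwa [Ne, Ideal.Quotient.eq_zero_iff_mem])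
  refine ⟨q, hq, fun x hx => hle ?_⟩
  rw [Submodule.mem_colon_singleton]
  exact (Ideal.Quotient.eq_zero_iff_mem (I := J)).2 hx

theorem IsAssociatedTo.notMem_of_isRegularModulo {q J : Ideal S} (hq : IsAssociatedTo q J) {z : S}
    (hz : IsRegularModulo z J) : z ∉ q := by
  obtain ⟨hp, a, ha⟩ := hq
  intro hzq
  have : a ∈ J := hz a ((ha z).1 hzq)
  exact hp.ne_top ((Ideal.eq_top_iff_one _).2 ((ha 1).2 (by simpa using this)))

theorem IsAssociatedTo.le {q J : Ideal S} (hq : IsAssociatedTo q J) : J ≤ q := by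
  obtain ⟨_, a, ha⟩ := hq
  exact fun x hx => (ha x).2 (Ideal.mul_mem_right _ _ hx)

/-- An ideal that lies in no associated prime of `S ⧸ J₁` or `S ⧸ J₂` contains an element which is
regular modulo both. -/
theorem exists_isRegularModulo_and [IsNoetherianRing S] {I J₁ J₂ : Ideal S}
    (h₁ : ∀ q, IsAssociatedTo q J₁ → ¬ I ≤ q) (h₂ : ∀ q, IsAssociatedTo q J₂ → ¬ I ≤ q) :
    ∃ w ∈ I, IsRegularModulo w J₁ ∧ IsRegularModulo w J₂ := by
  have fin : (associatedPrimes S (S ⧸ J₁) ∪ associatedPrimes S (S ⧸ J₂)).Finite :=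
    (associatedPrimes.finite _ _).union (associatedPrimes.finite _ _)
  have hnot : ¬ (I : Set S) ⊆
      ⋃ i ∈ associatedPrimes S (S ⧸ J₁) ∪ associatedPrimes S (S ⧸ J₂), (i : Set S) := by
    intro hsub
    obtain ⟨q, hq, hIq⟩ := (I.subset_union_prime_finite fin (f := id) 0 0
      fun q hq _ _ => hq.elim (fun h => h.1) (fun h => h.1)).1 hsub
    rcases hq with hq | hq
    · exact h₁ q (isAssociatedTo_of_mem_associatedPrimes hq) hIq
    · exact h₂ q (isAssociatedTo_of_mem_associatedPrimes hq) hIq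
  obtain ⟨w, hwI, hw⟩ := Set.not_subset.1 hnot
  simp only [Set.mem_iUnion, not_exists] at hw
  refine ⟨w, hwI, fun a ha => ?_, fun a ha => ?_⟩
  · by_contra hna
    obtain ⟨q, hq, hx⟩ := exists_isAssociatedTo_of_notMem hna
    exact hw q (Or.inl hq) (hx w ha)
  · by_contra hna
    obtain ⟨q, hq, hx⟩ := exists_isAssociatedTo_of_notMem hna
    exact hw q (Or.inr hq) (hx w ha)

theorem DepthModuloGE.ne_top [IsLocalRing S] : ∀ {r : ℕ} {J : Ideal S}, DepthModuloGE r J → J ≠ ⊤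
  | 0, _, h => h
  | r + 1, J, ⟨z, _, _, h⟩ => fun hJ => h.ne_top (by simp [hJ])

variable [IsLocalRing S] [IsNoetherianRing S]

open IsLocalRing

/-- Nakayama's lemma, in the form N ≤ J + zN. -/
theorem le_of_le_sup_smul {z : S} (hz : z ∈ maximalIdeal S) {J N : Ideal S}
    (h : ∀ n ∈ N, ∃ j ∈ J, ∃ m ∈ N, n = j + z * m) : N ≤ J := by
  refine Submodule.le_of_le_smul_of_le_jacobson_bot (I := Ideal.span {z})
    (IsNoetherian.noetherian N) ?_ ?_
  · rw [IsLocalRing.jacobson_eq_maximalIdeal ⊥ bot_ne_top, Ideal.span_le]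
    simpa using hz
  · intro n hn
    obtain ⟨j, hj, m, hm, rfl⟩ := h n hn
    exact Submodule.add_mem_sup hj
      (Submodule.smul_mem_smul (Ideal.mem_span_singleton_self z) hm)

theorem IsRegularModulo.swap {J : Ideal S} {z w : S} (hz : z ∈ maximalIdeal S)
    (hzJ : IsRegularModulo z J) (hwJ : IsRegularModulo w (J ⊔ Ideal.span {z})) :
    IsRegularModulo w J ∧ IsRegularModulo z (J ⊔ Ideal.span {w}) := by
  have hw : IsRegularModulo w J := by
    let N : Ideal S := Submodule.comap (LinearMap.mulLeft S w) J
    have hN : ∀ a, a ∈ N ↔ w * a ∈ J := fun a => Iff.rfl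
    have : N ≤ J := by
      refine le_of_le_sup_smul hz fun a ha => ?_
      have h1 : a ∈ J ⊔ Ideal.span {z} := hwJ a (le_sup_left (a := J) ((hN a).1 ha))
      obtain ⟨j, hj, b, rfl⟩ := mem_sup_span_singleton_iff.1 h1
      refine ⟨j, hj, b, (hN b).2 (hzJ _ ?_), rfl⟩
      have h2 := J.sub_mem ((hN _).1 ha) (J.mul_mem_left w hj)
      convert h2 using 1
      ring
    exact fun a ha => this ((hN a).2 ha)
  refine ⟨hw, fun a ha => ?_⟩
  obtain ⟨j, hj, b, hab⟩ := mem_sup_span_singleton_iff.1 ha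
  have h1 : w * b ∈ J ⊔ Ideal.span {z} :=
    mem_sup_span_singleton_iff.2 ⟨-j, J.neg_mem hj, a, by rw [hab]; ring⟩
  obtain ⟨j', hj', b', rfl⟩ := mem_sup_span_singleton_iff.1 (hwJ b h1)
  have h2 : z * (a - w * b') ∈ J := by
    have : z * (a - w * b') = j + w * j' := by
      rw [mul_sub, hab]; ring
    rw [this]
    exact J.add_mem hj (J.mul_mem_left _ hj')
  exact mem_sup_span_singleton_iff.2 ⟨_, hzJ _ h2, b', by ring⟩

/-- Dividing by a regular element lowers the depth by at most one. -/
theorem DepthModuloGE.sup_span_singleton {r : ℕ} : ∀ {J : Ideal S} {g : S},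
    DepthModuloGE (r + 1) J → g ∈ maximalIdeal S → IsRegularModulo g J →
    DepthModuloGE r (J ⊔ Ideal.span {g}) := by
  induction r with
  | zero =>
    intro J g h hg _
    have hJ : J ≤ maximalIdeal S := le_maximalIdeal h.ne_top
    exact fun htop => (maximalIdeal.isMaximal S).ne_top (top_le_iff.1 (htop ▸
      sup_le hJ ((Ideal.span_singleton_le_iff_mem _).2 hg)))
  | succ r ih =>
    intro J g h hg hgJ
    obtain ⟨z, hz, hzJ, hdz⟩ := h
    obtain ⟨z₂, hz₂, hz₂J, -⟩ := id hdz
    -- If 𝔪 kills m modulo J + (g), then zm ≡ gm' and z₂m ≡ gb modulo J + (z), respectively with zm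
    -- taken modulo J, so g(z₂m' - zb) ∈ J. Cancelling g, then z₂ modulo J + (z), then z, puts m in
    -- J + (g).
    have hzero : ∀ q, IsAssociatedTo q (J ⊔ Ideal.span {g}) → ¬ maximalIdeal S ≤ q := by
      rintro q ⟨hq, m, hm⟩ hle
      have hmJ : m ∉ J ⊔ Ideal.span {g} := fun hmem =>
        hq.ne_top ((Ideal.eq_top_iff_one _).2 ((hm 1).2 (by simpa using hmem)))
      obtain ⟨j, hj, m', hm'⟩ := mem_sup_span_singleton_iff.1 ((hm z).1 (hle hz))
      obtain ⟨j₂, hj₂, b, hb⟩ := mem_sup_span_singleton_iff.1 ((hm z₂).1 (hle hz₂))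
      have h1 : g * (z₂ * m' - z * b) ∈ J := by
        have : g * (z₂ * m' - z * b) = z * j₂ - z₂ * j := by
          linear_combination z₂ * (-hm') + z * hb
        rw [this]
        exact J.sub_mem (J.mul_mem_left _ hj₂) (J.mul_mem_left _ hj)
      have h2 : m' ∈ J ⊔ Ideal.span {z} := hz₂J _
        (mem_sup_span_singleton_iff.2 ⟨_, hgJ _ h1, b, by ring⟩)
      obtain ⟨j', hj', m'', rfl⟩ := mem_sup_span_singleton_iff.1 h2
      have h3 : z * (m - g * m'') ∈ J := by
        have : z * (m - g * m'') = j + g * j' := by linear_combination hm'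
        rw [this]
        exact J.add_mem hj (J.mul_mem_left _ hj')
      exact hmJ (mem_sup_span_singleton_iff.2 ⟨_, hzJ _ h3, m'', by ring⟩)
    -- Regular modulo both ideals, w links the two sequences: induction cuts J + (z) by w, and then
    -- J + (w) by g.
    obtain ⟨w, hw, hwg, hwz⟩ := exists_isRegularModulo_and (I := maximalIdeal S) hzero
      (J₂ := J ⊔ Ideal.span {z})
      fun q hq hle => hq.notMem_of_isRegularModulo hz₂J (hle hz₂)
    have hz' := (hzJ.swap hz hwz).2
    have hg' := (hgJ.swap hg hwg).2
    have hd : DepthModuloGE (r + 1) (J ⊔ Ideal.span {w}) :=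
      ⟨z, hz, hz', by rw [sup_right_comm]; exact ih hdz hw hwz⟩
    exact ⟨w, hw, hwg, by rw [sup_right_comm]; exact ih hd hg hg'⟩

/-- Nakayama shows that N = (J : q) is not inside J + (z). An element of N outside J + (z) is killed
by q modulo J + (z), so q lies in an associated prime of J + (z), which contains z while q does not.
-/
theorem IsAssociatedTo.exists_sup_span_singleton {J q : Ideal S} (hq : IsAssociatedTo q J) {z : S}
    (hz : z ∈ maximalIdeal S) (hzJ : IsRegularModulo z J) :
    ∃ q', IsAssociatedTo q' (J ⊔ Ideal.span {z}) ∧ q < q' := by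
  have hzq := hq.notMem_of_isRegularModulo hzJ
  obtain ⟨hp, a, ha⟩ := hq
  let N : Ideal S := ⨅ x ∈ q, Submodule.comap (LinearMap.mulLeft S x) J
  have hN : ∀ b, b ∈ N ↔ ∀ x ∈ q, x * b ∈ J := fun b => by
    simp [N, Submodule.mem_iInf]
  have haN : a ∈ N := (hN a).2 fun x hx => (ha x).1 hx
  have haJ : a ∉ J := fun h =>
    hp.ne_top ((Ideal.eq_top_iff_one _).2 ((ha 1).2 (by simpa using h)))
  have hNle : ¬ N ≤ J ⊔ Ideal.span {z} := by
    intro hle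
    refine haJ (le_of_le_sup_smul hz (N := N) (fun n hn => ?_) haN)
    obtain ⟨j, hj, m, rfl⟩ := mem_sup_span_singleton_iff.1 (hle hn)
    refine ⟨j, hj, m, (hN m).2 fun x hx => hzJ _ ?_, rfl⟩
    have h2 := J.sub_mem ((hN _).1 hn x hx) (J.mul_mem_left x hj)
    convert h2 using 1
    ring
  obtain ⟨b, hbN, hb⟩ := SetLike.not_le_iff_exists.1 hNle
  obtain ⟨q', hq', hx⟩ := exists_isAssociatedTo_of_notMem hb
  have hass := isAssociatedTo_of_mem_associatedPrimes hq'
  refine ⟨q', hass, lt_of_le_of_ne (fun x hxq => hx x (le_sup_left (a := J) ((hN b).1 hbN x hxq)))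
    ?_⟩
  rintro rfl
  exact hzq (hass.le (Ideal.mem_sup_right (Ideal.mem_span_singleton_self z)))

theorem IsAssociatedTo.exists_between {r : ℕ} {J q : Ideal S} (hq : IsAssociatedTo q J)
    (h : DepthModuloGE (r + 2) J) : ∃ q' : Ideal S, q'.IsPrime ∧ q < q' ∧ q' < maximalIdeal S := by
  obtain ⟨z, hz, hzJ, z₂, hz₂, hz₂J, -⟩ := h
  obtain ⟨q₁, hq₁, h1⟩ := hq.exists_sup_span_singleton hz hzJ
  obtain ⟨q₂, hq₂, h2⟩ := hq₁.exists_sup_span_singleton hz₂ hz₂J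
  exact ⟨q₁, hq₁.1, h1, h2.trans_le (le_maximalIdeal hq₂.1.ne_top)⟩

/-- The chain grows downwards from P. In depth at least two, associated primes of J leave room under
the maximal ideal, so none contains P and some g ∈ P is regular modulo J. Cutting by g costs one
unit of depth, and a minimal prime of J below the head of the chain for J + (g) misses g, so it adds
one term. -/
theorem DepthModuloGE.exists_ltSeries {r : ℕ} : ∀ {J : Ideal S} (P : PrimeSpectrum S),
    DepthModuloGE r J → J ≤ P.asIdeal →
    (∀ q : Ideal S, q.IsPrime → P.asIdeal < q → ¬ q < maximalIdeal S) →
    ∃ c : LTSeries (PrimeSpectrum S), r ≤ c.length + 1 ∧ J ≤ c.head.asIdeal ∧ c.last = P := by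
  induction r with
  | zero => exact fun P _ hJ _ => ⟨RelSeries.singleton _ P, by simp, hJ, rfl⟩
  | succ r ih =>
    intro J P hd hJ hP
    -- In depth one no cut is guaranteed; this is the unit lost in `r ≤ c.length + 1`.
    obtain _ | r := r
    · exact ⟨RelSeries.singleton _ P, by simp, hJ, rfl⟩
    have hnot : ∀ q, IsAssociatedTo q J → ¬ P.asIdeal ≤ q := by
      intro q hq hle
      obtain ⟨q', hq', h1, h2⟩ := hq.exists_between hd
      exact hP q' hq' (hle.trans_lt h1) h2
    obtain ⟨g, hgP, hg, -⟩ := exists_isRegularModulo_and hnot hnot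
    have hgm : g ∈ maximalIdeal S := le_maximalIdeal P.2.ne_top hgP
    obtain ⟨c, hc, hhead, hlast⟩ := ih P (hd.sup_span_singleton hgm hg)
      (sup_le hJ ((Ideal.span_singleton_le_iff_mem _).2 hgP)) hP
    have := c.head.2
    obtain ⟨p, hp, hpc⟩ := Ideal.exists_minimalPrimes_le (le_sup_left.trans hhead)
    have hgp : g ∉ p := by
      intro hgp
      obtain ⟨y, hy, hgy⟩ := Ideal.exists_mul_mem_of_mem_minimalPrimes hp hgp
      exact hy (hg y hgy)
    have hlt : (⟨p, hp.1.1⟩ : PrimeSpectrum S) < c.head := by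
      refine lt_of_le_of_ne hpc ?_
      intro heq
      have hpe : p = c.head.asIdeal := congrArg PrimeSpectrum.asIdeal heq
      rw [hpe] at hgp
      exact hgp (hhead (Ideal.mem_sup_right (Ideal.mem_span_singleton_self g)))
    refine ⟨c.cons ⟨p, hp.1.1⟩ hlt, ?_, ?_, ?_⟩
    · rw [RelSeries.cons_length]; omega
    · rw [RelSeries.head_cons]; exact hp.1.2
    · rw [RelSeries.last_cons]; exact hlast

/-- In a local ring of depth at least `r`, a prime below which no room is left under the maximal
ideal has height at least `r - 1`. -/
theorem DepthModuloGE.le_height_add_one {r : ℕ} (h : DepthModuloGE r (⊥ : Ideal S)) (P : Ideal S)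
    [hP : P.IsPrime] (hmax : ∀ q : Ideal S, q.IsPrime → P < q → ¬ q < maximalIdeal S) :
    (r : ℕ∞) ≤ P.height + 1 := by
  obtain ⟨c, hc, -, hlast⟩ := h.exists_ltSeries ⟨P, hP⟩ bot_le hmax
  have h1 : (c.length : ℕ∞) ≤ P.height := by
    have := PrimeSpectrum.height_eq_orderHeight (⟨P, hP⟩ : PrimeSpectrum S)
    rw [this, ← hlast]
    exact Order.length_le_height_last
  calc (r : ℕ∞) ≤ (c.length + 1 : ℕ) := by exact_mod_cast hc
    _ = c.length + 1 := by push_cast; rfl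
    _ ≤ P.height + 1 := by gcongr

end DepthModulo

/-! ### Ideals of power series rings and extension of coefficients -/

section MvPowerSeriesIdeals

namespace MvPowerSeries

variable {σ A : Type*} [CommRing A]

/-- Split off the monomials divisible by one variable at a time. The coefficient clause records that
the cofactors lose exactly one degree, which drives the induction for powers of (X). -/
theorem exists_eq_sum_X_mul [DecidableEq σ] (s : Finset σ) (f : MvPowerSeries σ A)
    (hf : ∀ m : σ →₀ ℕ, (∀ j ∈ s, m j = 0) → coeff m f = 0) :
    ∃ g : σ → MvPowerSeries σ A, f = ∑ j ∈ s, X j * g j ∧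
      ∀ j m, coeff m (g j) = 0 ∨ coeff m (g j) = coeff (m + Finsupp.single j 1) f := by
  induction s using Finset.induction_on generalizing f with
  | empty => exact ⟨fun _ => 0, by ext m; simpa using hf m (by simp), fun j m => Or.inl (by simp)⟩
  | insert i s hi ih =>
    let f₀ : MvPowerSeries σ A := fun m => if m i = 0 then coeff m f else 0
    let f₁ : MvPowerSeries σ A := fun m => coeff (m + Finsupp.single i 1) f
    have hf₀ : ∀ m, coeff m f₀ = if m i = 0 then coeff m f else 0 := fun m => rfl
    have hf₁ : ∀ m, coeff m f₁ = coeff (m + Finsupp.single i 1) f := fun m => rfl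
    obtain ⟨g, hg, hg'⟩ := ih f₀ fun m hm => by
      rw [hf₀]
      split_ifs with h
      · exact hf m (by simpa [h] using hm)
      · rfl
    have hdecomp : f = X i * f₁ + f₀ := by
      ext m
      rw [map_add, hf₀]
      by_cases h : m i = 0
      · have : coeff m (X i * f₁) = 0 := X_dvd_iff.1 ⟨f₁, rfl⟩ m h
        simp [h, this]
      · have hm : m = Finsupp.single i 1 + (m - Finsupp.single i 1) := by
          ext j
          by_cases hj : j = i
          · subst hj; simp; omega
          · simp [Ne.symm hj]
        rw [if_neg h, add_zero]
        conv_rhs => rw [hm, X, coeff_add_monomial_mul, one_mul, hf₁, add_comm, ← hm]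
    refine ⟨Function.update g i f₁, ?_, fun j m => ?_⟩
    · rw [Finset.sum_insert hi, Function.update_self]
      have : ∑ j ∈ s, X j * Function.update g i f₁ j = ∑ j ∈ s, X j * g j :=
        Finset.sum_congr rfl fun j hj => by
          rw [Function.update_of_ne (ne_of_mem_of_not_mem hj hi)]
      rw [this, ← hg, ← hdecomp]
    · by_cases hj : j = i
      · subst hj
        rw [Function.update_self]
        exact Or.inr (hf₁ m)
      · rw [Function.update_of_ne hj]
        rcases hg' j m with h | h
        · exact Or.inl h
        · rw [h, hf₀]
          split_ifs
          · exact Or.inr rfl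
          · exact Or.inl rfl

theorem mem_span_X_image_iff (s : Finset σ) (f : MvPowerSeries σ A) :
    f ∈ Ideal.span ((X : σ → MvPowerSeries σ A) '' s) ↔
      ∀ m : σ →₀ ℕ, (∀ j ∈ s, m j = 0) → coeff m f = 0 := by
  classical
  constructor
  · intro hf m hm
    induction hf using Submodule.span_induction generalizing m with
    | mem x hx =>
      obtain ⟨j, hj, rfl⟩ := hx
      exact X_dvd_iff.1 dvd_rfl m (hm j hj)
    | zero => simp
    | add x y _ _ hx hy => rw [map_add, hx m hm, hy m hm, add_zero]
    | smul a x _ hx =>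
      rw [smul_eq_mul, coeff_mul]
      refine Finset.sum_eq_zero fun p hp => ?_
      rw [hx p.2 fun j hj => ?_, mul_zero]
      have := hm j hj
      rw [← Finset.HasAntidiagonal.mem_antidiagonal.1 hp, Finsupp.add_apply] at this
      omega
  · intro hf
    obtain ⟨g, hg, -⟩ := exists_eq_sum_X_mul s f hf
    rw [hg]
    exact Ideal.sum_mem _ fun j hj =>
      Ideal.mul_mem_right _ _ (Ideal.subset_span (Set.mem_image_of_mem _ hj))

theorem mem_span_range_X_iff [Finite σ] (f : MvPowerSeries σ A) :
    f ∈ Ideal.span (Set.range (X : σ → MvPowerSeries σ A)) ↔ constantCoeff f = 0 := by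
  cases nonempty_fintype σ
  have h := mem_span_X_image_iff Finset.univ f
  rw [Finset.coe_univ, Set.image_univ] at h
  rw [h, ← coeff_zero_eq_constantCoeff_apply]
  constructor
  · exact fun h => h 0 (by simp)
  · intro h m hm
    rwa [show m = 0 from Finsupp.ext fun j => hm j (Finset.mem_univ j)]

theorem mem_span_range_X_pow [Finite σ] (N : ℕ) (f : MvPowerSeries σ A)
    (hf : ∀ m : σ →₀ ℕ, m.degree < N → coeff m f = 0) :
    f ∈ Ideal.span (Set.range (X : σ → MvPowerSeries σ A)) ^ N := by
  classical
  cases nonempty_fintype σ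
  induction N generalizing f with
  | zero => simp
  | succ N ih =>
    obtain ⟨g, hg, hg'⟩ := exists_eq_sum_X_mul Finset.univ f fun m hm => hf m (by
      rw [show m = 0 from Finsupp.ext fun j => hm j (Finset.mem_univ j)]; simp)
    rw [hg, pow_succ']
    refine Ideal.sum_mem _ fun j _ =>
      Ideal.mul_mem_mul (Ideal.subset_span ⟨j, rfl⟩) (ih _ fun m hm => ?_)
    rcases hg' j m with h | h
    · exact h
    · rw [h]
      refine hf _ ?_
      rw [map_add, Finsupp.degree_single]
      omega

theorem ker_constantCoeff_eq_span_range_X [Finite σ] :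
    RingHom.ker (constantCoeff : MvPowerSeries σ A →+* A) =
      Ideal.span (Set.range (X : σ → MvPowerSeries σ A)) := by
  ext f
  rw [RingHom.mem_ker, mem_span_range_X_iff]

theorem isRegularModulo_X (s : Finset σ) (i : σ) (hi : i ∉ s) :
    IsRegularModulo (X i : MvPowerSeries σ A) (Ideal.span (X '' (s : Set σ))) := by
  classical
  intro f hf
  rw [mem_span_X_image_iff] at hf ⊢
  intro m hm
  have := hf (Finsupp.single i 1 + m) fun j hj => by
    have : j ≠ i := fun h => hi (h ▸ hj)
    simp [hm j hj, this.symm]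
  rwa [X, coeff_add_monomial_mul, one_mul] at this

theorem maximalIdeal_eq_span_range_X [Finite σ] (k : Type*) [Field k] :
    IsLocalRing.maximalIdeal (MvPowerSeries σ k) =
      Ideal.span (Set.range (X : σ → MvPowerSeries σ k)) := by
  ext f
  rw [IsLocalRing.mem_maximalIdeal, mem_nonunits_iff, isUnit_iff_constantCoeff, isUnit_iff_ne_zero,
    not_not, mem_span_range_X_iff]

theorem depthModuloGE_span_X (k : Type*) [Field k] [Fintype σ] (r : ℕ) (s : Finset σ)
    (hs : s.card + r = Fintype.card σ) :
    DepthModuloGE r (Ideal.span ((X : σ → MvPowerSeries σ k) '' s)) := by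
  classical
  induction r generalizing s with
  | zero =>
    intro htop
    have h1 : (1 : MvPowerSeries σ k) ∈ Ideal.span ((X : σ → MvPowerSeries σ k) '' s) :=
      htop ▸ Submodule.mem_top
    rw [mem_span_X_image_iff] at h1
    simpa using h1 0 (by simp)
  | succ r ih =>
    obtain ⟨i, hi⟩ : ∃ i, i ∉ s := by
      by_contra! h
      rw [Finset.eq_univ_iff_forall.2 h, Finset.card_univ] at hs
      omega
    refine ⟨X i, ?_, isRegularModulo_X s i hi, ?_⟩
    · rw [maximalIdeal_eq_span_range_X]
      exact Ideal.subset_span ⟨i, rfl⟩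
    · have := ih (insert i s) (by rw [Finset.card_insert_of_notMem hi]; omega)
      rwa [Finset.coe_insert, Set.image_insert_eq, Set.insert_eq, Ideal.span_union,
        sup_comm] at this

theorem depthModuloGE_bot (k : Type*) [Field k] [Fintype σ] :
    DepthModuloGE (Fintype.card σ) (⊥ : Ideal (MvPowerSeries σ k)) := by
  simpa using depthModuloGE_span_X k (Fintype.card σ) (∅ : Finset σ) (by simp)

/-- Up to any order, an element of the extension of `P` to a ring of power series over an extension
field of `A` is approximated, after a linear projection of the coefficients to the fraction field of
`A` and multiplication by a common denominator, by elements of `P`. -/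
theorem exists_denominator_of_mem_map [IsDomain A] [Finite σ] {L L' : Type*} [Field L] [Field L']
    [Algebra A L] [IsFractionRing A L] [Algebra L L'] [Algebra A L'] [IsScalarTower A L L']
    (π : L' →ₗ[L] L) (P : Ideal (MvPowerSeries σ A))
    {s : MvPowerSeries σ L'} (hs : s ∈ P.map (map (algebraMap A L'))) (N : ℕ) :
    ∃ d : A, d ≠ 0 ∧ ∃ p ∈ P, ∀ m : σ →₀ ℕ, m.degree < N →
      algebraMap A L (coeff m p) = algebraMap A L d * π (coeff m s) := by
  classical
  cases nonempty_fintype σ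
  -- The free multiplier c makes the claim stable under scalar multiplication in the span induction.
  suffices H : ∀ c : MvPowerSeries σ L', ∃ d : A, d ≠ 0 ∧ ∃ p ∈ P, ∀ m : σ →₀ ℕ, m.degree < N →
      algebraMap A L (coeff m p) = algebraMap A L d * π (coeff m (c * s)) by
    simpa using H 1
  have hfin : {m : σ →₀ ℕ | m.degree < N}.Finite := Finsupp.finite_of_degree_lt N
  rw [Ideal.map] at hs
  induction hs using Submodule.span_induction with
  | mem x hx =>
    obtain ⟨p, hp, rfl⟩ := hx
    intro c
    obtain ⟨d, hd⟩ := IsLocalization.exist_integer_multiples_of_finset (nonZeroDivisors A)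
      (hfin.toFinset.image fun m => π (coeff m c))
    choose! a ha using fun m (hm : m.degree < N) =>
      hd (π (coeff m c)) (Finset.mem_image_of_mem _ (hfin.mem_toFinset.2 hm))
    let c' : MvPowerSeries σ A := fun m => a m
    have hc' : ∀ m, coeff m c' = a m := fun m => rfl
    refine ⟨d, nonZeroDivisors.ne_zero d.2, c' * p, P.mul_mem_left _ hp, fun m hm => ?_⟩
    -- As p has coefficients in A and π is L-linear, π(cp) = π(c)p; d clears the denominators of
    -- π(c) below degree N.
    rw [coeff_mul, coeff_mul, map_sum, map_sum, Finset.mul_sum]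
    refine Finset.sum_congr rfl fun ij hij => ?_
    have hdeg : ij.1.degree < N := by
      rw [← Finset.HasAntidiagonal.mem_antidiagonal.1 hij, map_add] at hm
      omega
    rw [map_mul, hc', ha _ hdeg, coeff_map, IsScalarTower.algebraMap_apply A L L', mul_comm
      (coeff ij.1 c), ← Algebra.smul_def (R := L) (A := L'), map_smul, smul_eq_mul, Algebra.smul_def]
    ring
  | zero => exact fun c => ⟨1, one_ne_zero, 0, P.zero_mem, fun m _ => by simp⟩
  | add x y _ _ hx hy =>
    intro c
    obtain ⟨d, hd, p, hp, h⟩ := hx c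
    obtain ⟨e, he, q, hq, h'⟩ := hy c
    refine ⟨d * e, mul_ne_zero hd he, C e * p + C d * q,
      P.add_mem (P.mul_mem_left _ hp) (P.mul_mem_left _ hq), fun m hm => ?_⟩
    rw [mul_add, map_add, map_add, coeff_C_mul, coeff_C_mul, map_add, map_add, map_mul, map_mul, map_mul,
      h m hm, h' m hm]
    ring
  | smul a x _ hx =>
    intro c
    simpa [mul_assoc] using hx (c * a)

/-- An ideal `P` of `A` contained in a prime `𝔪` is closed in the adic topology of the localization
at `𝔪`. -/
theorem _root_.Ideal.IsPrime.mem_of_forall_pow {R : Type*} [CommRing R] [IsNoetherianRing R]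
    {P M : Ideal R} [hP : P.IsPrime] [hM : M.IsPrime] (hPM : P ≤ M) {h : R}
    (H : ∀ N : ℕ, ∃ d ∉ M, d * h ∈ P ⊔ M ^ N) : h ∈ P := by
  let T := Localization.AtPrime M
  let P' : Ideal T := P.map (algebraMap R T)
  have hnoeth : IsNoetherianRing T := IsLocalization.isNoetherianRing M.primeCompl T inferInstance
  have hmem : algebraMap R T h ∈ P' := by
    have hbot := Ideal.iInf_pow_smul_eq_bot_of_isLocalRing (M := T ⧸ P')
      (IsLocalRing.maximalIdeal T) (IsLocalRing.maximalIdeal.isMaximal T).ne_top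
    rw [← Ideal.Quotient.eq_zero_iff_mem, ← Submodule.mem_bot T, ← hbot, Submodule.mem_iInf]
    intro N
    obtain ⟨d, hd, hdh⟩ := H N
    have h1 : algebraMap R T (d * h) ∈ P' ⊔ IsLocalRing.maximalIdeal T ^ N := by
      have := Ideal.mem_map_of_mem (algebraMap R T) hdh
      rw [Ideal.map_sup, Ideal.map_pow, Localization.AtPrime.map_eq_maximalIdeal] at this
      exact this
    have hunit : IsUnit (algebraMap R T d) :=
      IsLocalization.map_units T (⟨d, hd⟩ : M.primeCompl)
    rw [map_mul, Ideal.unit_mul_mem_iff_mem _ hunit] at h1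
    obtain ⟨p, hp, t, ht, hpt⟩ := Submodule.mem_sup.1 h1
    rw [← hpt, map_add, Ideal.Quotient.eq_zero_iff_mem.2 hp, zero_add]
    have : Ideal.Quotient.mk P' t = t • (1 : T ⧸ P') := (mul_one (Ideal.Quotient.mk P' t)).symm
    rw [this]
    exact Submodule.smul_mem_smul ht Submodule.mem_top
  have := IsLocalization.under_map_of_isPrime_disjoint M.primeCompl T hP
    (Set.disjoint_left.2 fun x hx hxP => hx (hPM hxP))
  rw [← this]
  exact hmem

/-- Since π splits L → L', it returns the coefficients of h unchanged. So modulo each power of (X),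
a nonzero constant multiple of h lies in P. Nonzero constants are units in the localization at (X),
where Krull's intersection theorem makes P closed. -/
theorem comap_map_eq_of_le_span_X [IsDomain A] [IsNoetherianRing A] [Finite σ]
    {L L' : Type*} [Field L] [Field L'] [Algebra A L] [IsFractionRing A L] [Algebra L L']
    [Algebra A L'] [IsScalarTower A L L'] (P : Ideal (MvPowerSeries σ A)) [P.IsPrime]
    (hP : P ≤ Ideal.span (Set.range X)) :
    (P.map (map (algebraMap A L'))).comap (map (algebraMap A L')) = P := by
  refine le_antisymm (fun h hh => ?_) Ideal.le_comap_map
  obtain ⟨π, hπ⟩ := LinearMap.exists_leftInverse_of_injective (Algebra.linearMap L L')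
    (LinearMap.ker_eq_bot.2 (algebraMap L L').injective)
  have hprime : (Ideal.span (Set.range (X : σ → MvPowerSeries σ A))).IsPrime := by
    rw [← ker_constantCoeff_eq_span_range_X]
    exact RingHom.ker_isPrime _
  refine Ideal.IsPrime.mem_of_forall_pow hP fun N => ?_
  obtain ⟨d, hd, p, hp, H⟩ := exists_denominator_of_mem_map π P (Ideal.mem_comap.1 hh) N
  refine ⟨C d, by rwa [mem_span_range_X_iff, constantCoeff_C], ?_⟩
  rw [show C d * h = p + (C d * h - p) by ring]
  refine Submodule.add_mem_sup hp (mem_span_range_X_pow N _ fun m hm => ?_)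
  refine IsFractionRing.injective A L ?_
  rw [map_sub, coeff_C_mul, map_sub, H m hm, map_mul, coeff_map,
    IsScalarTower.algebraMap_apply A L L', map_zero]
  have := LinearMap.congr_fun hπ (algebraMap A L (coeff m h))
  simp only [LinearMap.comp_apply, Algebra.linearMap_apply, LinearMap.id_apply] at this
  rw [this, sub_self]

end MvPowerSeries

end MvPowerSeriesIdeals

/-! ### Automorphisms moving transcendental elements -/

section FieldAutomorphisms

universe u

open Cardinal in
open scoped IntermediateField.algebraAdjoinAdjoin in
theorem aleph0_lt_trdeg_adjoin_of_countable {k L : Type u} [Field k] [Field L] [Algebra k L]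
    (h : ℵ₀ < Algebra.trdeg k L) {T : Set L} (hT : T.Countable) :
    ℵ₀ < Algebra.trdeg (IntermediateField.adjoin k T) L := by
  have hpoly : Algebra.trdeg k (Algebra.adjoin k T) ≤ ℵ₀ := by
    let φ : MvPolynomial T k →ₐ[k] Algebra.adjoin k T :=
      MvPolynomial.aeval fun t : T => (⟨t, Algebra.subset_adjoin t.2⟩ : Algebra.adjoin k T)
    have hφ : Function.Surjective φ := by
      have hcomp : (Algebra.adjoin k T).val.comp φ = MvPolynomial.aeval fun t : T => (t : L) := by
        ext t; simp [φ]
      rintro ⟨x, hx⟩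
      have hx' := hx
      rw [Algebra.adjoin_eq_range] at hx'
      obtain ⟨p, hp⟩ := hx'
      refine ⟨p, Subtype.ext ?_⟩
      exact (DFunLike.congr_fun hcomp p).trans hp
    refine (trdeg_le_of_surjective φ hφ).trans ?_
    rw [MvPolynomial.trdeg_of_isDomain]
    simpa using hT.le_aleph0
  have halg : Algebra.trdeg (Algebra.adjoin k T) (IntermediateField.adjoin k T) = 0 :=
    trdeg_eq_zero
  have h1 := trdeg_add_eq k (Algebra.adjoin k T) (A := IntermediateField.adjoin k T)
  have h2 := trdeg_add_eq k (IntermediateField.adjoin k T) (A := L)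
  rw [halg, add_zero] at h1
  rw [← h1] at h2
  by_contra! hle
  exact absurd (h2 ▸ add_le_aleph0.2 ⟨hpoly, hle⟩) (not_le.2 h)

/-- A permutation of the basis acts on the polynomial ring it generates, and Ω is an algebraic
closure of that ring, so the action extends. -/
theorem IsTranscendenceBasis.exists_algEquiv_apply_eq {F Ω ι : Type*} [Field F] [Field Ω]
    [Algebra F Ω] [IsAlgClosed Ω] {x : ι → Ω} (hx : IsTranscendenceBasis F x) (e : ι ≃ ι) :
    ∃ σ : Ω ≃ₐ[F] Ω, ∀ i, σ (x i) = x (e i) := by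
  have := IsAlgClosed.isAlgClosure_of_transcendence_basis x hx
  let a := hx.1.aevalEquiv
  let τ : Algebra.adjoin F (Set.range x) ≃ₐ[F] Algebra.adjoin F (Set.range x) :=
    (a.symm.trans (MvPolynomial.renameEquiv F e)).trans a
  let σ₀ := IsAlgClosure.equivOfEquiv Ω Ω τ.toRingEquiv
  have hσ : ∀ s, σ₀ (algebraMap _ Ω s) = algebraMap _ Ω (τ s) :=
    IsAlgClosure.equivOfEquiv_algebraMap Ω Ω τ.toRingEquiv
  refine ⟨AlgEquiv.ofRingEquiv (f := σ₀) fun c => ?_, fun i => ?_⟩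
  · rw [IsScalarTower.algebraMap_apply F (Algebra.adjoin F (Set.range x)) Ω, hσ, τ.commutes]
  · have hai : ∀ i, algebraMap (Algebra.adjoin F (Set.range x)) Ω (a (MvPolynomial.X i)) = x i :=
      fun i => by simp [a]
    change σ₀ (x i) = _
    rw [← hai i, hσ, ← hai (e i)]
    simp [τ]

/-- If `L` has uncountable transcendence degree over `k`, then the automorphisms of the algebraic
closure of `L` over a countably generated extension of `k` act transitively on some infinite family
of elements of `L`. -/
theorem exists_infinite_family_conjugate {k L : Type u} [Field k] [Field L] [Algebra k L]
    (h : Cardinal.aleph0 < Algebra.trdeg k L) {T : Set L} (hT : T.Countable) :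
    ∃ (F : IntermediateField k L) (B : Set L), T ⊆ F ∧ B.Infinite ∧ ∀ a ∈ B, ∀ b ∈ B,
      ∃ σ : AlgebraicClosure L ≃+* AlgebraicClosure L,
        (∀ t ∈ F, σ (algebraMap L _ t) = algebraMap L _ t) ∧
        σ (algebraMap L _ a) = algebraMap L _ b := by
  classical
  let F := IntermediateField.adjoin k T
  have hF : Cardinal.aleph0 < Algebra.trdeg F L := aleph0_lt_trdeg_adjoin_of_countable h hT
  obtain ⟨B, hB⟩ := exists_isTranscendenceBasis F L
  have hB' : IsTranscendenceBasis F (algebraMap L (AlgebraicClosure L) ∘ ((↑) : B → L)) :=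
    hB.algebraMap_comp
  refine ⟨F, B, IntermediateField.subset_adjoin k T, ?_, fun a ha b hb => ?_⟩
  · rw [← hB.cardinalMk_eq_trdeg] at hF
    exact Set.infinite_coe_iff.1 (Cardinal.infinite_iff.2 hF.le)
  · obtain ⟨σ, hσ⟩ := hB'.exists_algEquiv_apply_eq (Equiv.swap ⟨a, ha⟩ ⟨b, hb⟩)
    refine ⟨σ.toRingEquiv, fun t ht => ?_, ?_⟩
    · exact σ.commutes ⟨t, ht⟩
    · simpa using hσ ⟨a, ha⟩

end FieldAutomorphisms

/-! ### Heights, and conjugates of minimal primes -/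

section MinimalPrimesAndHeights

variable {S : Type*} [CommRing S]

theorem two_le_height_map_mk_of_lt_of_lt {p W Q : Ideal S} [p.IsPrime] [hW : W.IsPrime]
    [hQ : Q.IsPrime] (h₁ : p < W) (h₂ : W < Q) : 2 ≤ (Q.map (Ideal.Quotient.mk p)).height := by
  have hsurj : Function.Surjective (Ideal.Quotient.mk p) := Ideal.Quotient.mk_surjective
  have hcm : ∀ J : Ideal S, p ≤ J →
      (J.map (Ideal.Quotient.mk p)).comap (Ideal.Quotient.mk p) = J := fun J hJ => by
    rw [Ideal.comap_map_of_surjective' _ hsurj, Ideal.mk_ker, sup_eq_left.2 hJ]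
  have hWp : (W.map (Ideal.Quotient.mk p)).IsPrime :=
    Ideal.map_isPrime_of_surjective hsurj (by rw [Ideal.mk_ker]; exact h₁.le)
  have hQp : (Q.map (Ideal.Quotient.mk p)).IsPrime :=
    Ideal.map_isPrime_of_surjective hsurj (by rw [Ideal.mk_ker]; exact h₁.le.trans h₂.le)
  have hlt₁ : (⊥ : Ideal (S ⧸ p)) < W.map (Ideal.Quotient.mk p) := by
    refine bot_lt_iff_ne_bot.2 fun h => h₁.ne ?_
    rw [← hcm W h₁.le, h, ← RingHom.ker_eq_comap_bot, Ideal.mk_ker]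
  have hlt₂ : W.map (Ideal.Quotient.mk p) < Q.map (Ideal.Quotient.mk p) := by
    refine lt_of_le_of_ne (Ideal.map_mono h₂.le) fun h => h₂.ne ?_
    rw [← hcm W h₁.le, h, hcm Q (h₁.le.trans h₂.le)]
  have e₁ := Ideal.height_add_one_le_of_lt_of_isPrime hlt₁
  have e₂ := Ideal.height_add_one_le_of_lt_of_isPrime hlt₂
  calc (2 : ℕ∞) = 0 + 1 + 1 := by norm_num
    _ ≤ (⊥ : Ideal (S ⧸ p)).height + 1 + 1 := by gcongr; exact zero_le
    _ ≤ _ := (add_le_add_left e₁ 1).trans e₂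

/-- No prime lies strictly between a prime `p` and a minimal prime of `p + (g)`. -/
theorem eq_of_lt_of_le_of_mem_minimalPrimes [IsNoetherianRing S] {p W Q : Ideal S} {g : S}
    [p.IsPrime] [W.IsPrime] (hQ : Q ∈ (p ⊔ Ideal.span {g}).minimalPrimes) (h₁ : p < W)
    (h₂ : W ≤ Q) : W = Q := by
  by_contra hne
  have := hQ.1.1
  have h := two_le_height_map_mk_of_lt_of_lt h₁ (lt_of_le_of_ne h₂ hne)
  exact absurd (h.trans (Ideal.map_height_le_one_of_mem_minimalPrimes hQ)) (by norm_num)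

/-- The inequality ht P₁ ≤ ht P + ht(P₁/PS), whose last term vanishes by minimality; no flatness is
needed. -/
theorem height_le_of_mem_minimalPrimes_map {R : Type*} [CommRing R] [IsNoetherianRing R]
    [IsNoetherianRing S] (f : R →+* S) {P : Ideal R} [P.IsPrime] {P₁ : Ideal S}
    (hP₁ : P₁ ∈ (P.map f).minimalPrimes) (hcomap : P₁.comap f = P) : P₁.height ≤ P.height := by
  algebraize [f]
  have := hP₁.1.1
  have : P₁.LiesOver P := ⟨hcomap.symm⟩
  have h := Ideal.height_le_height_add_of_liesOver P P₁
  have hsurj : Function.Surjective (Ideal.Quotient.mk (P.map f)) := Ideal.Quotient.mk_surjective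
  have hprime : (P₁.map (Ideal.Quotient.mk (P.map f))).IsPrime :=
    Ideal.map_isPrime_of_surjective hsurj (by rw [Ideal.mk_ker]; exact hP₁.1.2)
  have h0 : (P₁.map (Ideal.Quotient.mk (P.map f))).height = 0 := by
    rw [Ideal.height_eq_zero_iff]
    refine ⟨⟨hprime, bot_le⟩, fun J hJ hJle => ?_⟩
    have := hJ.1
    rw [Ideal.map_le_iff_le_comap]
    refine hP₁.2 ⟨Ideal.comap_isPrime _ _, ?_⟩ ?_
    · exact fun x hx => by
        rw [Ideal.mem_comap, Ideal.Quotient.eq_zero_iff_mem.2 hx]; exact J.zero_mem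
    · have := Ideal.comap_mono (f := Ideal.Quotient.mk (P.map f)) hJle
      rwa [Ideal.comap_map_of_surjective' _ hsurj, Ideal.mk_ker, sup_eq_left.2 hP₁.1.2] at this
  exact h.trans (by rw [RingHom.algebraMap_toAlgebra, h0, add_zero])

theorem height_add_three_le_ringKrullDim {P : Ideal S} [P.IsPrime]
    (h : 2 < ringKrullDim (S ⧸ P)) : ((P.height + 3 : ℕ∞) : WithBot ℕ∞) ≤ ringKrullDim S := by
  have h3 : ((3 : ℕ) : WithBot ℕ∞) ≤ ringKrullDim (S ⧸ P) := by
    rw [show ((3 : ℕ) : WithBot ℕ∞) = (2 : ℕ) + 1 by norm_num, ENat.WithBot.add_one_le_iff]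
    exact_mod_cast h
  obtain ⟨l, hl⟩ := Order.le_krullDim_iff.1 h3
  have hsurj : Function.Surjective (Ideal.Quotient.mk P) := Ideal.Quotient.mk_surjective
  let p : Fin (l.length + 1) → Ideal S := fun i => (l i).asIdeal.comap (Ideal.Quotient.mk P)
  have hp : ∀ i, (p i).IsPrime := fun i => Ideal.comap_isPrime _ _
  have hstep : ∀ i j, i < j → (p i).height + 1 ≤ (p j).height := fun i j hij => by
    have hlt : (l i).asIdeal < (l j).asIdeal := l.strictMono hij
    have : p i < p j := by
      refine lt_of_le_of_ne (Ideal.comap_mono hlt.le) fun h => hlt.ne ?_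
      exact Ideal.comap_injective_of_surjective _ hsurj h
    exact Ideal.height_add_one_le_of_lt_of_isPrime this
  have h0 : P.height ≤ (p ⟨0, by omega⟩).height := Ideal.height_mono fun x hx => by
    rw [Ideal.mem_comap, Ideal.Quotient.eq_zero_iff_mem.2 hx]; exact Ideal.zero_mem _
  have h1 := hstep ⟨0, by omega⟩ ⟨1, by omega⟩ (Fin.mk_lt_mk.2 (by norm_num))
  have h2 := hstep ⟨1, by omega⟩ ⟨2, by omega⟩ (Fin.mk_lt_mk.2 (by norm_num))
  have h3 := hstep ⟨2, by omega⟩ ⟨3, by omega⟩ (Fin.mk_lt_mk.2 (by norm_num))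
  have hlen : 3 < l.length + 1 := by omega
  have := hp ⟨3, hlen⟩
  have htop := Ideal.height_le_ringKrullDim_of_isPrime (I := p ⟨3, hlen⟩)
  refine le_trans ?_ htop
  refine WithBot.coe_le_coe.2 ?_
  calc P.height + 3 = P.height + 1 + 1 + 1 := by rw [add_assoc, add_assoc]; norm_num
    _ ≤ (p ⟨0, by omega⟩).height + 1 + 1 + 1 := by gcongr
    _ ≤ _ := ((add_le_add_left (add_le_add_left h1 1) 1).trans (add_le_add_left h2 1)).trans h3

/-- Let `P₁` be a minimal prime of `I` and `Q` a minimal prime of `P₁ + (u - ω v)` which contains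
some `f ∉ P₁`. If infinitely many automorphisms fix `u`, `v`, `f`, preserve `I`, and move `ω` to
elements with invertible differences, then `Q` contains `u` and `v`. -/
theorem mem_and_mem_of_infinite_conjugates [IsNoetherianRing S] {I P₁ Q : Ideal S}
    (hP₁ : P₁ ∈ I.minimalPrimes) {u v f ω : S}
    (hQ : Q ∈ (P₁ ⊔ Ideal.span {u - ω * v}).minimalPrimes)
    (hf : f ∉ P₁) (hfQ : f ∈ Q) {ι : Type*} [Infinite ι] (σ : ι → S ≃+* S)
    (hI : ∀ b, I.map (σ b) = I) (hu : ∀ b, σ b u = u) (hv : ∀ b, σ b v = v)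
    (hσf : ∀ b, σ b f = f) (hω : ∀ a b, a ≠ b → IsUnit (σ a ω - σ b ω)) : u ∈ Q ∧ v ∈ Q := by
  have hP₁p := hP₁.1.1
  have hQp := hQ.1.1
  have hP₁Q : P₁ ≤ Q := le_sup_left.trans hQ.1.2
  have hIinv : ∀ b x, σ b x ∈ I ↔ x ∈ I := fun b x => by
    conv_lhs => rw [← hI b]
    exact Ideal.mem_map_of_equiv (σ b) _ |>.trans
      ⟨fun ⟨y, hy, hxy⟩ => (σ b).injective hxy ▸ hy, fun h => ⟨x, h, rfl⟩⟩
  have hsymm : ∀ b x, σ b x = x → (σ b).symm x = x := fun b x h => by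
    rw [RingEquiv.symm_apply_eq, h]
  let W : ι → Ideal S := fun b => Q.comap (σ b).symm
  have hmin : ∀ b, P₁.comap (σ b).symm ∈ I.minimalPrimes := fun b => by
    refine ⟨⟨Ideal.comap_isPrime _ _, fun x hx => hP₁.1.2 ?_⟩, fun J hJ hJle x hx => ?_⟩
    · rw [← hIinv b]; simpa using hx
    · have := hJ.1
      have hle : P₁ ≤ J.comap (σ b) := hP₁.2
        ⟨Ideal.comap_isPrime _ _, fun y hy => hJ.2 ((hIinv b y).2 hy)⟩
        fun y hy => by simpa using hJle hy
      have hx' : σ b ((σ b).symm x) ∈ J := hle hx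
      rwa [RingEquiv.apply_symm_apply] at hx'
  -- Nothing lies strictly between P₁ and Q, so f ∉ P₁ makes Q minimal over P₁ + (f). Transport by σ
  -- b, which permutes the minimal primes of I.
  have hW : ∀ b, W b ∈ ⋃ p ∈ I.minimalPrimes, (p ⊔ Ideal.span {f}).minimalPrimes := fun b => by
    refine Set.mem_biUnion (hmin b) ⟨⟨Ideal.comap_isPrime _ _, sup_le (Ideal.comap_mono hP₁Q) ?_⟩,
      fun J hJ hJle x hx => ?_⟩
    · rw [Ideal.span_singleton_le_iff_mem]
      change (σ b).symm f ∈ Q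
      rwa [hsymm b f (hσf b)]
    · have := hJ.1
      have hfJ : f ∈ J := hJ.2 (Ideal.mem_sup_right (Ideal.mem_span_singleton_self f))
      have hle : P₁ ≤ J.comap (σ b) := fun y hy =>
        hJ.2 (Ideal.mem_sup_left (by simpa using hy))
      have hlt : P₁ < J.comap (σ b) := lt_of_le_of_ne hle fun h => hf <| by
        rw [h]
        change σ b f ∈ J
        rwa [hσf b]
      have heq := eq_of_lt_of_le_of_mem_minimalPrimes hQ hlt
        fun y hy => by simpa [W] using hJle hy
      have hx' : (σ b).symm x ∈ Q := hx
      rw [← heq, Ideal.mem_comap, RingEquiv.apply_symm_apply] at hx'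
      exact hx'
  have hfin : (⋃ p ∈ I.minimalPrimes, (p ⊔ Ideal.span {f}).minimalPrimes).Finite :=
    (I.finite_minimalPrimes_of_isNoetherianRing S).biUnion
      fun p _ => Ideal.finite_minimalPrimes_of_isNoetherianRing S _
  have := hfin.to_subtype
  obtain ⟨a, b, hab, hWab⟩ := Finite.exists_ne_map_eq_of_infinite
    fun b => (⟨W b, hW b⟩ : (⋃ p ∈ I.minimalPrimes, (p ⊔ Ideal.span {f}).minimalPrimes : Set _))
  have hWab : W a = W b := congrArg Subtype.val hWab
  have hWmem : ∀ c, u - σ c ω * v ∈ W c := fun c => by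
    change (σ c).symm (u - σ c ω * v) ∈ Q
    rw [map_sub, map_mul, hsymm c u (hu c), hsymm c v (hv c), RingEquiv.symm_apply_apply]
    exact hQ.1.2 (Ideal.mem_sup_right (Ideal.mem_span_singleton_self _))
  have hvW : v ∈ W a := by
    have h1 := (W a).sub_mem (hWab ▸ hWmem b : u - σ b ω * v ∈ W a) (hWmem a)
    rw [show u - σ b ω * v - (u - σ a ω * v) = (σ a ω - σ b ω) * v by ring,
      Ideal.unit_mul_mem_iff_mem _ (hω a b hab)] at h1
    exact h1
  have huW : u ∈ W a := by
    have := (W a).add_mem (hWmem a) ((W a).mul_mem_left (σ a ω) hvW)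
    simpa using this
  have huQ : (σ a).symm u ∈ Q := huW
  have hvQ : (σ a).symm v ∈ Q := hvW
  rw [hsymm a u (hu a)] at huQ
  rw [hsymm a v (hv a)] at hvQ
  exact ⟨huQ, hvQ⟩

end MinimalPrimesAndHeights

/-! ### Enlarging primes of K[[y, X]] -/

section PrimesOfPowerSeriesYX

universe u

variable {K : Type u} [Field K] {n : ℕ}

theorem mem_idealXR_iff {f : PowerSeriesYX K n} :
    f ∈ idealXR K n ↔ MvPowerSeries.constantCoeff f = 0 :=
  MvPowerSeries.mem_span_range_X_iff f

theorem idealXR_isPrime : (idealXR K n).IsPrime := by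
  rw [idealXR, ← MvPowerSeries.ker_constantCoeff_eq_span_range_X]
  exact RingHom.ker_isPrime _

theorem idealXR_lt_maximalIdeal :
    idealXR K n < IsLocalRing.maximalIdeal (PowerSeriesYX K n) := by
  refine lt_of_le_of_ne (IsLocalRing.le_maximalIdeal (idealXR_isPrime).ne_top) fun h => ?_
  have hy : (MvPowerSeries.C (PowerSeries.X : K⟦X⟧) : PowerSeriesYX K n) ∈
      IsLocalRing.maximalIdeal (PowerSeriesYX K n) := by
    rw [IsLocalRing.mem_maximalIdeal, mem_nonunits_iff, MvPowerSeries.isUnit_iff_constantCoeff,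
      MvPowerSeries.constantCoeff_C]
    exact PowerSeries.X_prime.not_isUnit
  rw [← h, mem_idealXR_iff, MvPowerSeries.constantCoeff_C] at hy
  exact PowerSeries.X_ne_zero hy

/-- Killing the n variables, which lie in the Jacobson radical, leaves K[[y]], of dimension at most
one. -/
theorem ringKrullDim_powerSeriesYX_le : ringKrullDim (PowerSeriesYX K n) ≤ (n + 1 : ℕ) := by
  have hsub : Set.range (fun i : Fin n => (MvPowerSeries.X i : PowerSeriesYX K n)) ⊆
      Ring.jacobson (PowerSeriesYX K n) := by
    rw [IsLocalRing.ringJacobson_eq_maximalIdeal]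
    exact Ideal.subset_span.trans idealXR_lt_maximalIdeal.le
  have hsurj : Function.Surjective
      (MvPowerSeries.constantCoeff : PowerSeriesYX K n →+* K⟦X⟧) :=
    fun a => ⟨MvPowerSeries.C a, MvPowerSeries.constantCoeff_C a⟩
  have hker : Ideal.span (Set.range fun i : Fin n => (MvPowerSeries.X i : PowerSeriesYX K n)) =
      RingHom.ker (MvPowerSeries.constantCoeff : PowerSeriesYX K n →+* K⟦X⟧) :=
    MvPowerSeries.ker_constantCoeff_eq_span_range_X.symm
  have hdim : ringKrullDim (PowerSeriesYX K n ⧸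
      Ideal.span (Set.range fun i : Fin n => (MvPowerSeries.X i : PowerSeriesYX K n))) ≤ (1 : ℕ) := by
    rw [hker, ringKrullDim_eq_of_ringEquiv (RingHom.quotientKerEquivOfSurjective hsurj)]
    exact Ring.krullDimLE_iff.1 inferInstance
  have hcard : ((Set.range fun i : Fin n =>
      (MvPowerSeries.X i : PowerSeriesYX K n)).encard : WithBot ℕ∞) ≤ (n : ℕ) := by
    have h : (Set.range fun i : Fin n => (MvPowerSeries.X i : PowerSeriesYX K n)).encard ≤ n := by
      rw [← Set.image_univ]
      refine (Set.encard_image_le _ _).trans ?_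
      simp
    exact_mod_cast h
  refine (ringKrullDim_le_ringKrullDim_quotient_add_encard _ hsub).trans ?_
  refine (add_le_add hdim hcard).trans (le_of_eq ?_)
  rw [add_comm n 1]
  push_cast
  rfl

theorem map_algEquiv_map_eq {σ A L L' : Type*} [CommRing A] [CommRing L] [CommRing L']
    [Algebra A L] [Algebra L L'] [Algebra A L'] [IsScalarTower A L L'] (τ : L' ≃+* L')
    {g : MvPowerSeries σ A}
    (h : ∀ m, τ (algebraMap L L' (algebraMap A L (MvPowerSeries.coeff m g))) =
      algebraMap L L' (algebraMap A L (MvPowerSeries.coeff m g))) :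
    MvPowerSeries.map (τ : L' →+* L') (MvPowerSeries.map (algebraMap A L') g) =
      MvPowerSeries.map (algebraMap A L') g := by
  ext m
  rw [MvPowerSeries.coeff_map, MvPowerSeries.coeff_map, IsScalarTower.algebraMap_apply A L L']
  exact h m

/-- The automorphism of a ring of power series induced by an automorphism of the coefficients. -/
noncomputable def mvPowerSeriesMapEquiv (σ : Type*) {A : Type*} [CommRing A] (τ : A ≃+* A) :
    MvPowerSeries σ A ≃+* MvPowerSeries σ A :=
  RingEquiv.ofRingHom (MvPowerSeries.map (τ : A →+* A)) (MvPowerSeries.map (τ.symm : A →+* A))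
    (by rw [← MvPowerSeries.map_comp]; ext; simp) (by rw [← MvPowerSeries.map_comp]; ext; simp)

/-- In the ring of power series over an extension field of `K((y))`, some minimal prime of the
extension of `P` lies over `P`, and there is room between it and the maximal ideal. -/
theorem exists_minimalPrime_over_of_two_lt_ringKrullDim {L' : Type*} [Field L'] [Algebra K⸨X⸩ L']
    [Algebra K⟦X⟧ L'] [IsScalarTower K⟦X⟧ K⸨X⸩ L'] (P : Ideal (PowerSeriesYX K n)) [P.IsPrime]
    (hPX : P ≤ idealXR K n) (hdim : 2 < ringKrullDim (PowerSeriesYX K n ⧸ P)) :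
    ∃ P₁ ∈ (P.map (MvPowerSeries.map (σ := Fin n) (algebraMap K⟦X⟧ L'))).minimalPrimes,
      P₁.comap (MvPowerSeries.map (algebraMap K⟦X⟧ L')) = P ∧
      ∃ q : Ideal (MvPowerSeries (Fin n) L'), q.IsPrime ∧ P₁ < q ∧
        q < IsLocalRing.maximalIdeal _ := by
  let φ := MvPowerSeries.map (σ := Fin n) (algebraMap K⟦X⟧ L')
  have hcomap : (P.map φ).comap φ = P :=
    MvPowerSeries.comap_map_eq_of_le_span_X (L := K⸨X⸩) P hPX
  obtain ⟨p', hp', hle, hp'P⟩ := Ideal.exists_comap_eq_of_mem_minimalPrimes φ (I := P.map φ) P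
    (by rw [hcomap, Ideal.minimalPrimes_eq_subsingleton_self]; rfl)
  obtain ⟨P₁, hP₁, hP₁p'⟩ := Ideal.exists_minimalPrimes_le hle
  have hP₁P : P₁.comap φ = P := le_antisymm (hp'P ▸ Ideal.comap_mono hP₁p')
    (Ideal.map_le_iff_le_comap.1 hP₁.1.2)
  refine ⟨P₁, hP₁, hP₁P, ?_⟩
  by_contra! hno
  have := hP₁.1.1
  have h1 := (MvPowerSeries.depthModuloGE_bot (σ := Fin n) L').le_height_add_one P₁ hno
  rw [Fintype.card_fin] at h1
  have h2 := height_le_of_mem_minimalPrimes_map φ hP₁ hP₁P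
  have h3 := (height_add_three_le_ringKrullDim hdim).trans ringKrullDim_powerSeriesYX_le
  have h4 : P.height + 3 ≤ ((n + 1 : ℕ) : ℕ∞) := by exact_mod_cast h3
  -- Without room above P₁, depth gives n ≤ ht P₁ + 1 ≤ ht P + 1, against ht P + 3 ≤ n + 1.
  have h5 : ((n + 2 : ℕ) : ℕ∞) ≤ ((n + 1 : ℕ) : ℕ∞) := by
    refine le_trans ?_ h4
    calc ((n + 2 : ℕ) : ℕ∞) = n + 2 := by push_cast; rfl
      _ ≤ P.height + 1 + 2 := by gcongr; exact h1.trans (by gcongr)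
      _ = P.height + 3 := by rw [add_assoc]; norm_num
  have := Nat.cast_le.1 h5
  omega

/-- A prime `P ⊆ XR` with `dim (R ⧸ P) > 2` can be enlarged inside `XR` without changing its
contraction to `R₀`. -/
theorem exists_prime_between_of_two_lt_ringKrullDim (V : Subring K⟦X⟧)
    (htr : Cardinal.aleph0 < Algebra.trdeg (quotientSubfield V) K⸨X⸩)
    (P : Ideal (PowerSeriesYX K n)) [P.IsPrime] (hPX : P ≤ idealXR K n)
    (hdim : 2 < ringKrullDim (PowerSeriesYX K n ⧸ P)) :
    ∃ Q : Ideal (PowerSeriesYX K n), Q.IsPrime ∧ P < Q ∧ Q < idealXR K n ∧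
      P.comap (inclR₀ V n) = Q.comap (inclR₀ V n) := by
  let L' := AlgebraicClosure K⸨X⸩
  let φ : PowerSeriesYX K n →+* MvPowerSeries (Fin n) L' := MvPowerSeries.map (algebraMap K⟦X⟧ L')
  obtain ⟨P₁, hP₁, hP₁P, q, hq, hP₁q, hqm⟩ :=
    exists_minimalPrime_over_of_two_lt_ringKrullDim (L' := L') P hPX hdim
  change P₁ ∈ (P.map φ).minimalPrimes at hP₁
  change P₁.comap φ = P at hP₁P
  have hP₁p := hP₁.1.1
  have hφP : ∀ f, φ f ∈ P₁ ↔ f ∈ P := fun f => by rw [← hP₁P]; rfl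
  have hXX : ∀ J : Ideal (MvPowerSeries (Fin n) L'), idealXR K n ≤ J.comap φ →
      IsLocalRing.maximalIdeal (MvPowerSeries (Fin n) L') ≤ J := by
    intro J hJ
    rw [MvPowerSeries.maximalIdeal_eq_span_range_X, Ideal.span_le]
    rintro _ ⟨i, rfl⟩
    have : φ (MvPowerSeries.X i) ∈ J := hJ (Ideal.subset_span ⟨i, rfl⟩)
    simpa [φ] using this
  have hmax : ∀ f, f ∈ idealXR K n ↔
      φ f ∈ IsLocalRing.maximalIdeal (MvPowerSeries (Fin n) L') := by
    intro f
    have hinj : Function.Injective (algebraMap K⟦X⟧ L') := by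
      rw [IsScalarTower.algebraMap_eq K⟦X⟧ K⸨X⸩ L']
      exact (algebraMap K⸨X⸩ L').injective.comp (IsFractionRing.injective K⟦X⟧ K⸨X⸩)
    rw [MvPowerSeries.maximalIdeal_eq_span_range_X, MvPowerSeries.mem_span_range_X_iff,
      mem_idealXR_iff, MvPowerSeries.constantCoeff_map, map_eq_zero_iff _ hinj]
  obtain ⟨u, huX, huP⟩ : ∃ u ∈ idealXR K n, u ∉ P := by
    by_contra! h
    exact absurd (hXX P₁ (hP₁P.symm ▸ h)) (hP₁q.trans hqm).not_ge
  have huP₁ : φ u ∉ P₁ := fun h => huP ((hφP u).1 h)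
  -- Prime avoidance: otherwise some w contains X and is the maximal ideal, and q lies strictly
  -- between P₁ and w, against the principal ideal theorem.
  obtain ⟨v, hvX, hv⟩ : ∃ v ∈ idealXR K n,
      ∀ w ∈ (P₁ ⊔ Ideal.span {φ u}).minimalPrimes, φ v ∉ w := by
    by_contra! h
    have hfin := Ideal.finite_minimalPrimes_of_isNoetherianRing _ (P₁ ⊔ Ideal.span {φ u})
    obtain ⟨_, ⟨w, hw, rfl⟩, hle⟩ := ((idealXR K n).subset_union_prime_finite
      (hfin.image fun w => w.comap φ) (f := id) ⊥ ⊥ (by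
        rintro _ ⟨w, hw, rfl⟩ _ _
        have := hw.1.1
        exact Ideal.comap_isPrime φ w)).1 (by
        intro v hv
        obtain ⟨w, hw, hvw⟩ := h v hv
        exact Set.mem_biUnion (Set.mem_image_of_mem _ hw) hvw)
    have hqw := eq_of_lt_of_le_of_mem_minimalPrimes hw hP₁q (hqm.le.trans (hXX w hle))
    exact (hqm.trans_le (hXX w hle)).ne hqw
  obtain ⟨G, hG⟩ := IsNoetherian.noetherian P
  let T : Set K⸨X⸩ := ⋃ g ∈ ((G : Set (PowerSeriesYX K n)) ∪ {u, v}),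
    Set.range fun m => algebraMap K⟦X⟧ K⸨X⸩ (MvPowerSeries.coeff m g)
  have hT : T.Countable := by
    refine Set.Countable.biUnion (Set.Countable.union G.countable_toSet ?_) fun g _ =>
      Set.countable_range _
    exact (Set.toFinite _).countable
  obtain ⟨F, B, hTF, hB, hconj⟩ := exists_infinite_family_conjugate htr hT
  -- Two failures in B would put v, and then u, in P₁.
  obtain ⟨ω, hωB, hω⟩ : ∃ ω ∈ B,
      φ u - MvPowerSeries.C (algebraMap K⸨X⸩ L' ω) * φ v ∉ P₁ := by
    by_contra! h
    obtain ⟨a, ha⟩ := hB.nonempty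
    obtain ⟨b, hb, hab⟩ := hB.exists_notMem_finite (Set.finite_singleton a)
    have hvP₁ : φ v ∈ P₁ := by
      have h1 := P₁.sub_mem (h a ha) (h b hb)
      rw [show ∀ x y z w : MvPowerSeries (Fin n) L', x - y * w - (x - z * w) = (z - y) * w from
        fun _ _ _ _ => by ring, ← map_sub, ← map_sub,
        Ideal.unit_mul_mem_iff_mem] at h1
      · exact h1
      · refine IsUnit.map _ (IsUnit.map _ (isUnit_iff_ne_zero.2 (sub_ne_zero.2 fun h => hab h)))
    have := P₁.add_mem (h a ha) (P₁.mul_mem_left (MvPowerSeries.C (algebraMap K⸨X⸩ L' a)) hvP₁)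
    rw [sub_add_cancel] at this
    exact huP₁ this
  let δ := φ u - MvPowerSeries.C (algebraMap K⸨X⸩ L' ω) * φ v
  have hδm : P₁ ⊔ Ideal.span {δ} ≤ IsLocalRing.maximalIdeal (MvPowerSeries (Fin n) L') :=
    sup_le (hP₁q.trans hqm).le ((Ideal.span_singleton_le_iff_mem _).2
      (Ideal.sub_mem _ ((hmax u).1 huX) (Ideal.mul_mem_left _ _ ((hmax v).1 hvX))))
  obtain ⟨Q', hQ', hQ'm⟩ := Ideal.exists_minimalPrimes_le hδm
  have hQ'p := hQ'.1.1
  have hδQ' : δ ∈ Q' := hQ'.1.2 (Ideal.mem_sup_right (Ideal.mem_span_singleton_self δ))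
  have hP₁Q' : P₁ ≤ Q' := le_sup_left.trans hQ'.1.2
  have hnotboth : ¬ (φ u ∈ Q' ∧ φ v ∈ Q') := by
    rintro ⟨hu', hv'⟩
    obtain ⟨W, hW, hWQ'⟩ := Ideal.exists_minimalPrimes_le (J := Q')
      (sup_le hP₁Q' ((Ideal.span_singleton_le_iff_mem _).2 hu'))
    have hWp := hW.1.1
    have hP₁W : P₁ < W := lt_of_le_of_ne (le_sup_left.trans hW.1.2) fun h => huP₁ <| by
      rw [h]; exact hW.1.2 (Ideal.mem_sup_right (Ideal.mem_span_singleton_self _))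
    have := eq_of_lt_of_le_of_mem_minimalPrimes hQ' hP₁W hWQ'
    exact hv W hW (this ▸ hv')
  have hPQ : P ≤ Q'.comap φ := hP₁P ▸ Ideal.comap_mono hP₁Q'
  refine ⟨Q'.comap φ, Ideal.comap_isPrime _ _, lt_of_le_of_ne hPQ fun heq => ?_,
    lt_of_le_of_ne (fun f hf => (hmax f).2 (hQ'm hf)) fun heq => ?_,
    le_antisymm (Ideal.comap_mono hPQ) fun f hf => ?_⟩
  -- With ω = a/d, the element du - av of R maps to d(u - ωv), which is in Q' but not in P₁.
  · obtain ⟨a, d, hd, hωad⟩ := IsFractionRing.div_surjective (A := K⟦X⟧) ω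
    have hd0 : algebraMap K⟦X⟧ K⸨X⸩ d ≠ 0 :=
      (map_ne_zero_iff _ (IsFractionRing.injective K⟦X⟧ K⸨X⸩)).2 (nonZeroDivisors.ne_zero hd)
    have hφ : φ (MvPowerSeries.C d * u - MvPowerSeries.C a * v) =
        MvPowerSeries.C (algebraMap K⸨X⸩ L' (algebraMap K⟦X⟧ K⸨X⸩ d)) * δ := by
      have hmul : algebraMap K⟦X⟧ K⸨X⸩ d * ω = algebraMap K⟦X⟧ K⸨X⸩ a := by
        rw [← hωad]; field_simp
      simp only [φ, δ, map_sub, map_mul, MvPowerSeries.map_C]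
      rw [mul_sub, ← mul_assoc, ← map_mul, ← map_mul, hmul, IsScalarTower.algebraMap_apply K⟦X⟧ K⸨X⸩ L',
        IsScalarTower.algebraMap_apply K⟦X⟧ K⸨X⸩ L']
    have hmem : MvPowerSeries.C d * u - MvPowerSeries.C a * v ∈ P := by
      rw [heq, Ideal.mem_comap, hφ]
      exact Q'.mul_mem_left _ hδQ'
    rw [← hφP, hφ, Ideal.unit_mul_mem_iff_mem _
      (IsUnit.map _ (IsUnit.map _ (isUnit_iff_ne_zero.2 hd0)))] at hmem
    exact hω hmem
  · exact hnotboth ⟨heq.symm.le huX, heq.symm.le hvX⟩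
  · by_contra hfP
    have hfP₁ : φ (inclR₀ V n f) ∉ P₁ := fun h => hfP ((hφP _).1 h)
    choose τ hτF hτω using fun b : B => hconj ω hωB b b.2
    let s : B → MvPowerSeries (Fin n) L' ≃+* MvPowerSeries (Fin n) L' :=
      fun b => mvPowerSeriesMapEquiv (Fin n) (τ b)
    have hfix : ∀ (b : B) (g : PowerSeriesYX K n),
        (∀ m, algebraMap K⟦X⟧ K⸨X⸩ (MvPowerSeries.coeff m g) ∈ F) → s b (φ g) = φ g :=
      fun b g hg => map_algEquiv_map_eq (L := K⸨X⸩) (τ b) fun m => hτF b _ (hg m)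
    have hTg : ∀ g ∈ ((G : Set (PowerSeriesYX K n)) ∪ {u, v}), ∀ m,
        algebraMap K⟦X⟧ K⸨X⸩ (MvPowerSeries.coeff m g) ∈ F :=
      fun g hg m => hTF (Set.mem_biUnion hg ⟨m, rfl⟩)
    have hinf : Infinite B := hB.to_subtype
    have hsω : ∀ b : B, s b (MvPowerSeries.C (algebraMap K⸨X⸩ L' ω)) =
        MvPowerSeries.C (algebraMap K⸨X⸩ L' b) := fun b => by
      change MvPowerSeries.map (τ b : L' →+* L') _ = _
      rw [MvPowerSeries.map_C, ← hτω b]; rfl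
    refine hnotboth (mem_and_mem_of_infinite_conjugates hP₁ hQ' hfP₁ hf s (fun b => ?_)
      (fun b => hfix b u (hTg u (by simp))) (fun b => hfix b v (hTg v (by simp)))
      (fun b => hfix b _ fun m => ?_) fun a b hab => ?_)
    · rw [← hG, Ideal.submodule_span_eq, Ideal.map_span, Ideal.map_span, ← Set.image_comp]
      congr 1
      exact Set.image_congr fun g hg => hfix b g (hTg g (Or.inl hg))
    · refine F.algebraMap_mem (⟨_, Subfield.subset_closure ⟨_, ?_, rfl⟩⟩ : quotientSubfield V)
      rw [inclR₀, MvPowerSeries.coeff_map]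
      exact (MvPowerSeries.coeff m f).2
    · rw [hsω, hsω, ← map_sub, ← map_sub]
      exact IsUnit.map _ (IsUnit.map _ (isUnit_iff_ne_zero.2
        (sub_ne_zero.2 fun h => hab (Subtype.ext h))))

theorem two_le_ringKrullDim_quotient_of_lt_idealXR {Q : Ideal (PowerSeriesYX K n)} [Q.IsPrime]
    (hQ : Q < idealXR K n) : 2 ≤ ringKrullDim (PowerSeriesYX K n ⧸ Q) := by
  have := idealXR_isPrime (K := K) (n := n)
  have h := two_le_height_map_mk_of_lt_of_lt hQ idealXR_lt_maximalIdeal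
  have hp : ((IsLocalRing.maximalIdeal (PowerSeriesYX K n)).map (Ideal.Quotient.mk Q)).IsPrime :=
    Ideal.map_isPrime_of_surjective Ideal.Quotient.mk_surjective
      (by rw [Ideal.mk_ker]; exact (hQ.trans idealXR_lt_maximalIdeal).le)
  refine le_trans ?_ (Ideal.height_le_ringKrullDim_of_isPrime
    (I := (IsLocalRing.maximalIdeal (PowerSeriesYX K n)).map (Ideal.Quotient.mk Q)))
  exact WithBot.coe_le_coe.2 h

end PrimesOfPowerSeriesYX

/-! ### Reaching dimension two by noetherian maximality -/

theorem theorem2p3 {K : Type*} [Field K] (n : ℕ)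
    (V : Subring K⟦X⟧) [IsDiscreteValuationRing V]
    (hKV : ∀ p : Polynomial K, (p : K⟦X⟧) ∈ V)
    -- the completion of `V` is `K[[y]]`, compatibly with the inclusion of `V` in `K[[y]]`
    (hcompl : Nonempty (AdicCompletion (IsLocalRing.maximalIdeal V) V ≃ₐ[V] K⟦X⟧))
    (htr : Cardinal.aleph0 < Algebra.trdeg (quotientSubfield V) K⸨X⸩)
    (P : Ideal (PowerSeriesYX K n)) [P.IsPrime]
    (hPX : P ≤ idealXR K n)
    (hdim : 2 < ringKrullDim (PowerSeriesYX K n ⧸ P)) :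
    ∃ Q : Ideal (PowerSeriesYX K n), Q.IsPrime ∧
      P < Q ∧ Q < idealXR K n ∧
      ringKrullDim (PowerSeriesYX K n ⧸ Q) = 2 ∧
      P.comap (inclR₀ V n) = Q.comap (inclR₀ V n) ∧
      P.comap (inclKX K n) = Q.comap (inclKX K n) := by
  obtain ⟨Q₀, hQ₀⟩ := exists_prime_between_of_two_lt_ringKrullDim V htr P hPX hdim
  obtain ⟨Q, ⟨hQ, hPQ, hQX, hcomap⟩, hQmax⟩ := set_has_maximal_iff_noetherian.2
    (inferInstance : IsNoetherian (PowerSeriesYX K n) (PowerSeriesYX K n))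
    {Q : Ideal (PowerSeriesYX K n) | Q.IsPrime ∧ P < Q ∧ Q < idealXR K n ∧
      P.comap (inclR₀ V n) = Q.comap (inclR₀ V n)} ⟨Q₀, hQ₀⟩
  refine ⟨Q, hQ, hPQ, hQX, le_antisymm ?_ (two_le_ringKrullDim_quotient_of_lt_idealXR hQX),
    hcomap, ?_⟩
  · by_contra! hlt
    obtain ⟨Q₁, hQ₁, hQQ₁, hQ₁X, hcomap₁⟩ :=
      exists_prime_between_of_two_lt_ringKrullDim V htr Q hQX.le hlt
    exact hQmax Q₁ ⟨hQ₁, hPQ.trans hQQ₁, hQ₁X, hcomap.trans hcomap₁⟩ hQQ₁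
  · let κ : K →+* V := (PowerSeries.C (R := K)).codRestrict V fun a => by
      simpa using hKV (Polynomial.C a)
    have hκ : inclKX K n = (inclR₀ V n).comp (MvPowerSeries.map κ) := by
      rw [inclR₀, inclKX, ← MvPowerSeries.map_comp]
      rfl
    rw [hκ, ← Ideal.comap_comap, ← Ideal.comap_comap, hcomap]
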